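/- Let functions of $x$ and $t=t_n$ be matrix functions on $X\times T$, where $X\subseteq\mathbb R$ is a non-empty open interval (possibly unbounded) and $T\subseteq\mathbb R$ is open. Let $D=\partial/\partial x$, and for a matrix function $f$ let $D^{-1}\{f\}$ be its antiderivative in $x$ that tends to $0$ at a fixed base point $x_0$, a point or an end point (possibly $\pm\infty$) of $X$. Curly brackets denote the action of an operator on a function; products of operators are compositions. The formal adjoint $\tau$ is the linear anti-automorphism with $h^\tau=h^\top$ (for multiplication by a matrix function $h$), $D^\tau=-D$, $\partial_t^\tau=-\partial_t$, $(D^{-1})^\tau=-D^{-1}$, $(PQ)^\tau=Q^\tau P^\tau$. Let $$M_n=\alpha_n\partial_{t_n}-\tilde{\mathcal J}_nD^n-\sum_{i=0}^{n-1}v_iD^i-\mathbf q\mathcal M_0D^{-1}\mathbf r^\top,$$ where $n\ge 0$, $\alpha_n\in\mathbb C$, $\tilde{\mathcal J}_n$ is a constant $N\times N$ matrix, $v_i$ are $N\times N$ matrix functions, $\mathbf q,\mathbf r$ are $N\times m$ matrix functions and $\mathcal M_0$ is a constant $m\times m$ matrix. Let $\varphi,\psi$ be $N\times K$ matrix functions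 and $\Lambda,\tilde\Lambda$ constant complex $K\times K$ matrices with $$M_n\{\varphi\}=\varphi\Lambda,\qquad M_n^\tau\{\psi\}=\psi\tilde\Lambda .$$ Let $C$ be a constant nondegenerate $K\times K$ matrix such that $D^{-1}\{\psi^\top\varphi\}$ exists and $\Delta:=C+D^{-1}\{\psi^\top\varphi\}$ is invertible at every point of $X\times T$. Put $$W=I-\varphi\Delta^{-1}D^{-1}\psi^\top,\quad W^{-1}=I+\varphi D^{-1}\Delta^{-1}\psi^\top,\quad \hat M_n=WM_nW^{-1},\quad \Phi=\varphi\Delta^{-1},\quad \Psi=\psi(\Delta^{-1})^\top,$$ and $\mathcal M_{j}=C\Lambda^{j}-(\tilde\Lambda^\top)^{j}C$ for $j\ge1$. Then the functions $$\Phi[j]:=(\hat M_n)^j\{\Phi\},\qquad \Psi[j]:=(\hat M_n^\tau)^j\{\Psi\}\qquad(j\ge 0)$$ exist, and for every integer $l\ge0$ $$\Phi\mathcal M_{l+1}D^{-1}\Psi^\top=\sum_{s=0}^{l}\Phi[s]\,\mathcal M_1D^{-1}\Psi^\top[l-s],$$ where $\Psi^\top[j]=(\Psi[j])^\top$. The identity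 holds for the two sides as operators acting on matrix functions (they are defined on the same functions and have the same values), and also coefficient by coefficient for the expansions $h_1D^{-1}h_2=\sum_{k\ge0}(-1)^kh_1D^k\{h_2\}D^{-1-k}$ in the algebra of formal pseudodifferential operators: for each $k$, if the $k$-th $x$-derivatives on one side exist then so do those on the other, and the coefficients of $D^{-1-k}$ agree. -/

import Mathlib

open Filter Topology

/-- Matrix-valued functions of the two real variables `x` (first) and `t` (second). -/
abbrev MatFun (a b : ℕ) : Type := ℝ → ℝ → Matrix (Fin a) (Fin b) ℂ

/-- The data on which all functions live: an open interval of the variable `x` with (possibly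
infinite) end points, an open set of values of `t`, and the base point at which `D⁻¹` is
normalised. The base point lies in the interval or is one of its end points, so that
`D⁻¹{f} = ∫_{x₀}^x f`, `∫_{-∞}^x f` and `-∫_x^∞ f` are all included. -/
structure Region where
  lo : EReal
  hi : EReal
  lo_lt_hi : lo < hi
  base : EReal
  base_mem : base ∈ Set.Icc lo hi
  times : Set ℝ
  isOpen_times : IsOpen times

namespace Region

/-- The interval of the variable `x`. -/
def space (R : Region) : Set ℝ := {x : ℝ | R.lo < (x : EReal) ∧ (x : EReal) < R.hi}

/-- `x` tends to the base point inside the interval. -/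
noncomputable def toBase (R : Region) : Filter ℝ :=
  comap (fun x : ℝ => (x : EReal)) (𝓝 R.base) ⊓ 𝓟 R.space

/-- Equality of two functions on the region. -/
def EqOn (R : Region) {a b : ℕ} (f g : MatFun a b) : Prop :=
  ∀ x ∈ R.space, ∀ t ∈ R.times, f x t = g x t

end Region

/-- Pointwise product of matrix functions. -/
def MatFun.mul {a b c : ℕ} (f : MatFun a b) (g : MatFun b c) : MatFun a c :=
  fun x t => f x t * g x t

/-- Pointwise transpose `f^⊤`. -/
def MatFun.tr {a b : ℕ} (f : MatFun a b) : MatFun b a := fun x t => (f x t).transpose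

/-- A constant matrix as a matrix function. -/
def MatFun.const {a b : ℕ} (A : Matrix (Fin a) (Fin b) ℂ) : MatFun a b := fun _ _ => A

/-- Integro-differential operators with matrix-function coefficients: they are generated, under
sums, scalar multiples and compositions, by the multiplications by matrix functions and by
`D = ∂/∂x`, `∂_t` and `D⁻¹`. An element of `IDO b a` acts on matrix functions with `a` rows and
returns matrix functions with `b` rows. -/
inductive IDO : ℕ → ℕ → Type
  | mul {a b : ℕ} (h : MatFun b a) : IDO b a
  | dx (a : ℕ) : IDO a a
  | dt (a : ℕ) : IDO a a
  | dinv (a : ℕ) : IDO a a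
  | smul {a b : ℕ} (z : ℂ) (P : IDO b a) : IDO b a
  | add {a b : ℕ} (P Q : IDO b a) : IDO b a
  | comp {a b c : ℕ} (P : IDO c b) (Q : IDO b a) : IDO c a

namespace IDO

/-- Formal adjoint `P^τ`: `h^τ = h^⊤`, `D^τ = -D`, `∂_t^τ = -∂_t`, `(D⁻¹)^τ = -D⁻¹`,
`(zP)^τ = z P^τ`, `(P + Q)^τ = P^τ + Q^τ`, `(PQ)^τ = Q^τ P^τ`. -/
def adj : {b a : ℕ} → IDO b a → IDO a b
  | _, _, mul h => mul h.tr
  | _, _, dx a => smul (-1) (dx a)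
  | _, _, dt a => smul (-1) (dt a)
  | _, _, dinv a => smul (-1) (dinv a)
  | _, _, smul z P => smul z (adj P)
  | _, _, add P Q => add (adj P) (adj Q)
  | _, _, comp P Q => comp (adj Q) (adj P)

/-- `HasAct R P f g`: the function `P{f}` exists on the region and equals `g` there.
`D⁻¹{f}` is the antiderivative of `f` in `x` which tends to `0` at the base point. -/
def HasAct (R : Region) {p : ℕ} : {b a : ℕ} → IDO b a → MatFun a p → MatFun b p → Prop
  | _, _, mul h, f, g => R.EqOn g (h.mul f)
  | _, _, dx _, f, g => ∀ x ∈ R.space, ∀ t ∈ R.times, ∀ i j,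
      HasDerivAt (fun s => f s t i j) (g x t i j) x
  | _, _, dt _, f, g => ∀ x ∈ R.space, ∀ t ∈ R.times, ∀ i j,
      HasDerivAt (fun s => f x s i j) (g x t i j) t
  | _, _, dinv _, f, g =>
      (∀ x ∈ R.space, ∀ t ∈ R.times, ∀ i j, HasDerivAt (fun s => g s t i j) (f x t i j) x) ∧
      (∀ t ∈ R.times, ∀ i j, Tendsto (fun s => g s t i j) R.toBase (𝓝 0))
  | _, _, smul z P, f, g => ∃ h, HasAct R P f h ∧ R.EqOn g (fun x t => z • h x t)
  | _, _, add P Q, f, g =>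
      ∃ h k, HasAct R P f h ∧ HasAct R Q f k ∧ R.EqOn g (fun x t => h x t + k x t)
  | _, _, comp P Q, f, g => ∃ h, HasAct R Q f h ∧ HasAct R P h g

/-- The identity operator. -/
def one (a : ℕ) : IDO a a := mul (MatFun.const 1)

/-- `P - Q`. -/
def sub {a b : ℕ} (P Q : IDO b a) : IDO b a := add P (smul (-1) Q)

/-- `P ^ j`. -/
def pow {a : ℕ} (P : IDO a a) : ℕ → IDO a a
  | 0 => one a
  | j + 1 => comp P (pow P j)

/-- `P 0 + ⋯ + P (n - 1)`. -/
def sum {a b : ℕ} (P : ℕ → IDO b a) : ℕ → IDO b a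
  | 0 => mul (MatFun.const 0)
  | n + 1 => add (sum P n) (P n)

/-- The operator `h₁ D⁻¹ h₂`. -/
def integral {a b c : ℕ} (h₁ : MatFun c b) (h₂ : MatFun b a) : IDO c a :=
  comp (mul h₁) (comp (dinv b) (mul h₂))

/-- Two operators are equal: they act on the same matrix functions, with the same result. -/
def SameAction (R : Region) {a b : ℕ} (P Q : IDO b a) : Prop :=
  ∀ (p : ℕ) (f : MatFun a p) (g : MatFun b p), HasAct R P f g ↔ HasAct R Q f g

end IDO

/-- `w` is the coefficient of `D^{-1-k}` of `h₁ D⁻¹ h₂` in the algebra of formal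
pseudodifferential operators, where `h₁ D⁻¹ h₂ = ∑_{k ≥ 0} (-1)^k h₁ D^k{h₂} D^{-1-k}`. -/
def HasPDOCoeff (R : Region) {a b c : ℕ} (h₁ : MatFun c b) (h₂ : MatFun b a) (k : ℕ)
    (w : MatFun c a) : Prop :=
  ∃ g : MatFun b a, ((IDO.dx b).pow k).HasAct R h₂ g ∧
    R.EqOn w (fun x t => (-1 : ℂ) ^ k • (h₁ x t * g x t))

/-- `A_n = J D^n + ∑_{i < n} v_i D^i`. -/
def opA {N : ℕ} (n : ℕ) (J : Matrix (Fin N) (Fin N) ℂ) (v : ℕ → MatFun N N) : IDO N N :=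
  .add (.comp (.mul (.const J)) ((IDO.dx N).pow n))
    (.sum (fun i => .comp (.mul (v i)) ((IDO.dx N).pow i)) n)

/-- `M_n = α ∂_t - A_n - q 𝓜₀ D⁻¹ r^⊤`. -/
def opM {N m : ℕ} (n : ℕ) (α : ℂ) (J : Matrix (Fin N) (Fin N) ℂ) (v : ℕ → MatFun N N)
    (q r : MatFun N m) (M₀ : Matrix (Fin m) (Fin m) ℂ) : IDO N N :=
  .sub (.sub (.smul α (.dt N)) (opA n J v)) (.integral (q.mul (.const M₀)) r.tr)

/-- `Δ = C + S`, used with `S = D⁻¹{ψ^⊤ φ}`. -/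
def bdtDelta {K : ℕ} (C : Matrix (Fin K) (Fin K) ℂ) (S : MatFun K K) : MatFun K K :=
  fun x t => C + S x t

/-- The pointwise inverse matrix. -/
noncomputable def MatFun.inv {K : ℕ} (f : MatFun K K) : MatFun K K := fun x t => (f x t)⁻¹

/-- The binary Darboux transformation `W = I - φ Δ⁻¹ D⁻¹ ψ^⊤`. -/
noncomputable def bdtW {N K : ℕ} (φ ψ : MatFun N K) (Δ : MatFun K K) : IDO N N :=
  .sub (.one N) (.integral (φ.mul Δ.inv) ψ.tr)

/-- The inverse `W⁻¹ = I + φ D⁻¹ Δ⁻¹ ψ^⊤` of the binary Darboux transformation. -/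
noncomputable def bdtWInv {N K : ℕ} (φ ψ : MatFun N K) (Δ : MatFun K K) : IDO N N :=
  .add (.one N) (.integral φ (Δ.inv.mul ψ.tr))

/-- The dressed operator `W M W⁻¹`. -/
noncomputable def dressed {N K : ℕ} (φ ψ : MatFun N K) (Δ : MatFun K K) (M : IDO N N) :
    IDO N N :=
  .comp (bdtW φ ψ Δ) (.comp M (bdtWInv φ ψ Δ))

/-- `Φ = φ Δ⁻¹`. -/
noncomputable def bdtPhi {N K : ℕ} (φ : MatFun N K) (Δ : MatFun K K) : MatFun N K :=
  φ.mul Δ.inv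

/-- `Ψ = ψ (Δ⁻¹)^⊤`. -/
noncomputable def bdtPsi {N K : ℕ} (ψ : MatFun N K) (Δ : MatFun K K) : MatFun N K :=
  ψ.mul Δ.inv.tr

/-- `𝓜_j = C Λ^j - (Λ'^⊤)^j C`, where `Λ'` is the matrix of the adjoint problem. -/
def matM {K : ℕ} (C Λ Λ' : Matrix (Fin K) (Fin K) ℂ) (j : ℕ) : Matrix (Fin K) (Fin K) ℂ :=
  C * Λ ^ j - Λ'.transpose ^ j * C

/-! The operators `W` and `W⁻¹` are evaluated only at the functions that matter. Since `Δ⁻¹(C + S) =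
1` and `D⁻¹{Δ⁻¹ψ^⊤φΔ⁻¹} = C⁻¹ - Δ⁻¹`, one gets `W{φ} = ΦC` and `W⁻¹{Φ} = φC⁻¹`; the adjoints act
likewise on `ψ` and `Ψ`. Constant right factors pass through every operator, so `Φ` and `Ψ` are
eigenfunctions of `M̂` and `M̂^τ` with conjugated matrix eigenvalues (`dressed_hasAct`,
`dressed_adj_hasAct`). Hence `Φ[j] = ΦCΛ^jC⁻¹` and `Ψ^⊤[j] = C⁻¹(Λ'^⊤)^jCΨ^⊤`.

Constant matrices also commute with `D⁻¹` and `D^k` from the left, so both forms of the identity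
reduce to one identity of constant matrices, a telescoping sum (`sum_matM`). `hasAct_telescope`
carries it back to operators, including the equality of domains. -/

namespace Region

/-! ### Topology of the region and of the base point. -/

variable (R : Region)

theorem isOpen_space : IsOpen R.space :=
  isOpen_Ioo.preimage EReal.isEmbedding_coe.continuous

theorem isPreconnected_space : IsPreconnected R.space :=
  Set.OrdConnected.isPreconnected
    ⟨fun _ hx _ hy _ hz => ⟨hx.1.trans_le (EReal.coe_le_coe_iff.2 hz.1),
      (EReal.coe_le_coe_iff.2 hz.2).trans_lt hy.2⟩⟩

/-- In `EReal` the closure of a non-empty open interval contains its end points, infinite ones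
included. Nontriviality of the filter makes limits at the base point unique, hence `D⁻¹`
single-valued. -/
instance toBase_neBot : R.toBase.NeBot := by
  have himage : (fun x : ℝ => (x : EReal)) '' R.space = Set.Ioo R.lo R.hi := by
    ext y
    constructor
    · rintro ⟨x, hx, rfl⟩
      exact hx
    · intro hy
      lift y to ℝ using ⟨(hy.2.trans_le le_top).ne, (bot_le.trans_lt hy.1).ne'⟩
      exact ⟨y, hy, rfl⟩
  have hne : (𝓝[Set.Ioo R.lo R.hi] R.base).NeBot := by
    rw [← mem_closure_iff_nhdsWithin_neBot, closure_Ioo R.lo_lt_hi.ne]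
    exact R.base_mem
  rw [nhdsWithin, ← himage, ← Filter.map_principal, ← Filter.push_pull'] at hne
  exact hne.of_map

theorem space_mem_toBase : R.space ∈ R.toBase :=
  mem_inf_of_right (mem_principal_self _)

variable {R} {a b c d : ℕ}

theorem EqOn.refl (f : MatFun a b) : R.EqOn f f := fun _ _ _ _ => rfl

theorem EqOn.symm {f g : MatFun a b} (h : R.EqOn f g) : R.EqOn g f :=
  fun x hx t ht => (h x hx t ht).symm

theorem EqOn.trans {f g k : MatFun a b} (h : R.EqOn f g) (h' : R.EqOn g k) : R.EqOn f k :=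
  fun x hx t ht => (h x hx t ht).trans (h' x hx t ht)

theorem EqOn.mul {f f' : MatFun a b} {g g' : MatFun b c} (hf : R.EqOn f f')
    (hg : R.EqOn g g') : R.EqOn (f.mul g) (f'.mul g') := fun x hx t ht => by
  simp only [MatFun.mul, hf x hx t ht, hg x hx t ht]

theorem EqOn.tr {f f' : MatFun a b} (hf : R.EqOn f f') : R.EqOn f.tr f'.tr :=
  fun x hx t ht => by simp only [MatFun.tr, hf x hx t ht]

theorem EqOn.eventuallyEq_space {f g : MatFun a b} (h : R.EqOn f g) {x t : ℝ}
    (hx : x ∈ R.space) (ht : t ∈ R.times) (i : Fin a) (j : Fin b) :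
    (fun s => f s t i j) =ᶠ[𝓝 x] fun s => g s t i j := by
  filter_upwards [R.isOpen_space.mem_nhds hx] with s hs
  rw [h s hs t ht]

theorem EqOn.eventuallyEq_times {f g : MatFun a b} (h : R.EqOn f g) {x t : ℝ}
    (hx : x ∈ R.space) (ht : t ∈ R.times) (i : Fin a) (j : Fin b) :
    (fun s => f x s i j) =ᶠ[𝓝 t] fun s => g x s i j := by
  filter_upwards [R.isOpen_times.mem_nhds ht] with s hs
  rw [h x hx s hs]

theorem EqOn.eventuallyEq_toBase {f g : MatFun a b} (h : R.EqOn f g) {t : ℝ}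
    (ht : t ∈ R.times) (i : Fin a) (j : Fin b) :
    (fun s => f s t i j) =ᶠ[R.toBase] fun s => g s t i j := by
  filter_upwards [R.space_mem_toBase] with s hs
  rw [h s hs t ht]

end Region

/-! ### Entrywise calculus of matrix functions. -/

section Matrix

variable {a b c : ℕ}

theorem Matrix.hasDerivAt_const_mul (A : Matrix (Fin a) (Fin b) ℂ)
    {f : ℝ → Matrix (Fin b) (Fin c) ℂ} {f' : Matrix (Fin b) (Fin c) ℂ} {x : ℝ}
    (h : ∀ i j, HasDerivAt (fun s => f s i j) (f' i j) x) (i j) :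
    HasDerivAt (fun s => (A * f s) i j) ((A * f') i j) x := by
  simp only [Matrix.mul_apply]
  exact HasDerivAt.fun_sum fun k _ => (h k j).const_mul _

theorem Matrix.hasDerivAt_mul_const {f : ℝ → Matrix (Fin a) (Fin b) ℂ}
    {f' : Matrix (Fin a) (Fin b) ℂ} (A : Matrix (Fin b) (Fin c) ℂ) {x : ℝ}
    (h : ∀ i j, HasDerivAt (fun s => f s i j) (f' i j) x) (i j) :
    HasDerivAt (fun s => (f s * A) i j) ((f' * A) i j) x := by
  simp only [Matrix.mul_apply]
  exact HasDerivAt.fun_sum fun k _ => (h i k).mul_const _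

theorem Matrix.tendsto_of_entries {ι : Type*} {l : Filter ι} {f : ι → Matrix (Fin a) (Fin b) ℂ}
    {A : Matrix (Fin a) (Fin b) ℂ} (h : ∀ i j, Tendsto (fun s => f s i j) l (𝓝 (A i j))) :
    Tendsto f l (𝓝 A) :=
  tendsto_pi_nhds.2 fun i => tendsto_pi_nhds.2 fun j => h i j

theorem Matrix.tendsto_entry {ι : Type*} {l : Filter ι} {f : ι → Matrix (Fin a) (Fin b) ℂ}
    {A : Matrix (Fin a) (Fin b) ℂ} (h : Tendsto f l (𝓝 A)) (i j) :
    Tendsto (fun s => f s i j) l (𝓝 (A i j)) :=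
  tendsto_pi_nhds.1 (tendsto_pi_nhds.1 h i) j

theorem Matrix.tendsto_mul {ι : Type*} {l : Filter ι} {f : ι → Matrix (Fin a) (Fin b) ℂ}
    {g : ι → Matrix (Fin b) (Fin c) ℂ} {A : Matrix (Fin a) (Fin b) ℂ}
    {B : Matrix (Fin b) (Fin c) ℂ} (hf : Tendsto f l (𝓝 A)) (hg : Tendsto g l (𝓝 B)) :
    Tendsto (fun s => f s * g s) l (𝓝 (A * B)) := by
  refine Matrix.tendsto_of_entries fun i j => ?_
  simp only [Matrix.mul_apply]
  exact tendsto_finsetSum _ fun k _ =>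
    (Matrix.tendsto_entry hf i k).mul (Matrix.tendsto_entry hg k j)

theorem Matrix.tendsto_inv {ι : Type*} {l : Filter ι} {f : ι → Matrix (Fin a) (Fin a) ℂ}
    {A : Matrix (Fin a) (Fin a) ℂ} (hA : A.det ≠ 0) (hf : Tendsto f l (𝓝 A)) :
    Tendsto (fun s => (f s)⁻¹) l (𝓝 A⁻¹) := by
  refine (continuousAt_matrix_inv A ?_).tendsto.comp hf
  rw [Ring.inverse_eq_inv']
  exact continuousAt_inv₀ hA

/-- The derivative of the inverse of a matrix function. -/
theorem Matrix.hasDerivAt_inv {f : ℝ → Matrix (Fin a) (Fin a) ℂ} {f' : Matrix (Fin a) (Fin a) ℂ}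
    {x : ℝ} (h : ∀ i j, HasDerivAt (fun s => f s i j) (f' i j) x)
    (hdet : ∀ᶠ s in 𝓝 x, (f s).det ≠ 0) (i j) :
    HasDerivAt (fun s => (f s)⁻¹ i j) ((-((f x)⁻¹ * f' * (f x)⁻¹)) i j) x := by
  have hslope : Tendsto (slope f x) (𝓝[≠] x) (𝓝 f') :=
    Matrix.tendsto_of_entries fun i j => hasDerivAt_iff_tendsto_slope.1 (h i j)
  have hcont : Tendsto f (𝓝[≠] x) (𝓝 (f x)) :=
    Matrix.tendsto_of_entries fun i j => (h i j).continuousAt.tendsto.mono_left nhdsWithin_le_nhds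
  have hlim := Matrix.tendsto_mul (Matrix.tendsto_mul
    (Matrix.tendsto_inv hdet.self_of_nhds hcont) hslope)
    (tendsto_const_nhds (x := (f x)⁻¹))
  rw [hasDerivAt_iff_tendsto_slope]
  refine (Matrix.tendsto_entry hlim.neg i j).congr' ?_
  filter_upwards [hdet.filter_mono nhdsWithin_le_nhds] with s hs
  -- Resolvent identity: the slope of the inverse is `-(f s)⁻¹ * slope f x s * (f x)⁻¹`.
  have h1 : (f s)⁻¹ * (f s - f x) * (f x)⁻¹ = (f x)⁻¹ - (f s)⁻¹ := by
    rw [Matrix.mul_sub, Matrix.nonsing_inv_mul _ (isUnit_iff_ne_zero.2 hs), Matrix.sub_mul,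
      Matrix.mul_assoc, Matrix.mul_nonsing_inv _ (isUnit_iff_ne_zero.2 hdet.self_of_nhds)]
    simp
  simp only [slope, vsub_eq_sub, Matrix.mul_smul, Matrix.smul_mul, h1, ← smul_neg, neg_sub,
    Matrix.smul_apply, Matrix.sub_apply]

end Matrix

/-! ### Locality, uniqueness and constant factors for the action of operators. -/

namespace IDO

variable {R : Region} {a b c p p' : ℕ}

/-- Values off the region are irrelevant: `R.space` and `R.times` are open, so derivatives there see
only the region. -/
theorem HasAct.congr {P : IDO b a} {f f' : MatFun a p} {g g' : MatFun b p}
    (h : P.HasAct R f g) (hf : R.EqOn f f') (hg : R.EqOn g g') : P.HasAct R f' g' := by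
  induction P with
  | mul k => exact hg.symm.trans (h.trans ((Region.EqOn.refl k).mul hf))
  | dx =>
    intro x hx t ht i j
    rw [← hg x hx t ht]
    exact (h x hx t ht i j).congr_of_eventuallyEq (hf.symm.eventuallyEq_space hx ht i j)
  | dt =>
    intro x hx t ht i j
    rw [← hg x hx t ht]
    exact (h x hx t ht i j).congr_of_eventuallyEq (hf.symm.eventuallyEq_times hx ht i j)
  | dinv =>
    refine ⟨fun x hx t ht i j => ?_, fun t ht i j =>
      (h.2 t ht i j).congr' (hg.eventuallyEq_toBase ht i j)⟩
    rw [← hf x hx t ht]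
    exact (h.1 x hx t ht i j).congr_of_eventuallyEq (hg.symm.eventuallyEq_space hx ht i j)
  | smul z P ih =>
    obtain ⟨k, hk, hk'⟩ := h
    exact ⟨k, ih hk hf (.refl _), hg.symm.trans hk'⟩
  | add P Q ihP ihQ =>
    obtain ⟨k, l, hk, hl, hkl⟩ := h
    exact ⟨k, l, ihP hk hf (.refl _), ihQ hl hf (.refl _), hg.symm.trans hkl⟩
  | comp P Q ihP ihQ =>
    obtain ⟨k, hk, hk'⟩ := h
    exact ⟨k, ihQ hk hf (.refl _), ihP hk' (.refl _) hg⟩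

theorem HasAct.unique {P : IDO b a} {f : MatFun a p} {g g' : MatFun b p}
    (h : P.HasAct R f g) (h' : P.HasAct R f g') : R.EqOn g g' := by
  induction P with
  | mul k => exact Region.EqOn.trans h (Region.EqOn.symm h')
  | dx =>
    intro x hx t ht
    ext i j
    exact (h x hx t ht i j).unique (h' x hx t ht i j)
  | dt =>
    intro x hx t ht
    ext i j
    exact (h x hx t ht i j).unique (h' x hx t ht i j)
  | dinv =>
    intro x hx t ht
    ext i j
    -- Two antiderivatives differ by a constant on the interval, and the limit at the base point
    -- forces it to be zero.
    have hd : ∀ y ∈ R.space, HasDerivAt (fun s => g s t i j - g' s t i j) 0 y := fun y hy => by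
      simpa using (h.1 y hy t ht i j).fun_sub (h'.1 y hy t ht i j)
    have hconst : (fun s => g s t i j - g' s t i j) =ᶠ[R.toBase]
        fun _ => g x t i j - g' x t i j := by
      filter_upwards [R.space_mem_toBase] with s hs
      exact R.isOpen_space.is_const_of_deriv_eq_zero R.isPreconnected_space
        (fun y hy => (hd y hy).differentiableAt.differentiableWithinAt)
        (fun y hy => (hd y hy).deriv) hs hx
    have hlim := (h.2 t ht i j).sub (h'.2 t ht i j)
    rw [sub_zero] at hlim
    exact sub_eq_zero.1 (tendsto_nhds_unique (tendsto_const_nhds.congr' hconst.symm) hlim)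
  | smul z P ih =>
    obtain ⟨k, hk, hg⟩ := h
    obtain ⟨k', hk', hg'⟩ := h'
    intro x hx t ht
    simp only [hg x hx t ht, hg' x hx t ht, ih hk hk' x hx t ht]
  | add P Q ihP ihQ =>
    obtain ⟨k, l, hk, hl, hg⟩ := h
    obtain ⟨k', l', hk', hl', hg'⟩ := h'
    intro x hx t ht
    simp only [hg x hx t ht, hg' x hx t ht, ihP hk hk' x hx t ht, ihQ hl hl' x hx t ht]
  | comp P Q ihP ihQ =>
    obtain ⟨k, hk, hg⟩ := h
    obtain ⟨k', hk', hg'⟩ := h'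
    exact ihP hg (hg'.congr (ihQ hk' hk) (.refl _))

/-- Operators commute with multiplication by constant matrices from the right. -/
theorem HasAct.mul_const {P : IDO b a} {f : MatFun a p} {g : MatFun b p}
    (h : P.HasAct R f g) (A : Matrix (Fin p) (Fin p') ℂ) :
    P.HasAct R (f.mul (.const A)) (g.mul (.const A)) := by
  induction P with
  | mul k =>
    intro x hx t ht
    simp only [MatFun.mul, h x hx t ht, Matrix.mul_assoc]
  | dx => exact fun x hx t ht => Matrix.hasDerivAt_mul_const A (h x hx t ht)
  | dt => exact fun x hx t ht => Matrix.hasDerivAt_mul_const A (h x hx t ht)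
  | dinv =>
    refine ⟨fun x hx t ht => Matrix.hasDerivAt_mul_const A (h.1 x hx t ht), fun t ht i j => ?_⟩
    have hlim : Tendsto (fun s => g s t) R.toBase (𝓝 0) :=
      Matrix.tendsto_of_entries (h.2 t ht)
    simpa [MatFun.mul, MatFun.const] using Matrix.tendsto_entry
      (Matrix.tendsto_mul hlim (tendsto_const_nhds (x := A))) i j
  | smul z P ih =>
    obtain ⟨k, hk, hg⟩ := h
    refine ⟨_, ih hk, fun x hx t ht => ?_⟩
    simp only [MatFun.mul, hg x hx t ht, Matrix.smul_mul]
  | add P Q ihP ihQ =>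
    obtain ⟨k, l, hk, hl, hg⟩ := h
    refine ⟨_, _, ihP hk, ihQ hl, fun x hx t ht => ?_⟩
    simp only [MatFun.mul, hg x hx t ht, Matrix.add_mul]
  | comp P Q ihP ihQ =>
    obtain ⟨k, hk, hg⟩ := h
    exact ⟨_, ihQ hk, ihP hg⟩

theorem HasAct.dinv_const_mul {f g : MatFun a p} (h : (dinv a).HasAct R f g)
    (A : Matrix (Fin b) (Fin a) ℂ) :
    (dinv b).HasAct R ((MatFun.const A).mul f) ((MatFun.const A).mul g) := by
  refine ⟨fun x hx t ht => Matrix.hasDerivAt_const_mul A (h.1 x hx t ht), fun t ht i j => ?_⟩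
  have hlim : Tendsto (fun s => g s t) R.toBase (𝓝 0) := Matrix.tendsto_of_entries (h.2 t ht)
  simpa [MatFun.mul, MatFun.const] using Matrix.tendsto_entry
    (Matrix.tendsto_mul (tendsto_const_nhds (x := A)) hlim) i j

theorem HasAct.dinv_tr {f g : MatFun a a} (h : (dinv a).HasAct R f g) :
    (dinv a).HasAct R f.tr g.tr :=
  ⟨fun x hx t ht i j => h.1 x hx t ht j i, fun t ht i j => h.2 t ht j i⟩

theorem HasAct.dx_pow_const_mul {k : ℕ} {f g : MatFun a p} (h : ((dx a).pow k).HasAct R f g)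
    (A : Matrix (Fin b) (Fin a) ℂ) :
    ((dx b).pow k).HasAct R ((MatFun.const A).mul f) ((MatFun.const A).mul g) := by
  induction k generalizing g with
  | zero =>
    intro x hx t ht
    simp only [MatFun.mul, h x hx t ht, MatFun.const, Matrix.one_mul]
  | succ k ih =>
    obtain ⟨u, hu, hg⟩ := h
    exact ⟨_, ih hu, fun x hx t ht => Matrix.hasDerivAt_const_mul A (hg x hx t ht)⟩

theorem hasAct_integral_iff {h₁ : MatFun c b} {h₂ : MatFun b a} {f : MatFun a p}
    {g : MatFun c p} : (integral h₁ h₂).HasAct R f g ↔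
      ∃ u, (dinv b).HasAct R (h₂.mul f) u ∧ R.EqOn g (h₁.mul u) := by
  constructor
  · rintro ⟨u, ⟨k, hk, hu⟩, hg⟩
    exact ⟨u, hu.congr hk (.refl _), hg⟩
  · rintro ⟨u, hu, hg⟩
    exact ⟨u, ⟨_, Region.EqOn.refl _, hu⟩, hg⟩

theorem hasAct_sum_iff {P : ℕ → IDO b a} {n : ℕ} {f : MatFun a p} {g : MatFun b p} :
    (sum P n).HasAct R f g ↔ ∃ gs : ℕ → MatFun b p,
      (∀ s ∈ Finset.range n, (P s).HasAct R f (gs s)) ∧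
      R.EqOn g (fun x t => ∑ s ∈ Finset.range n, gs s x t) := by
  induction n generalizing g with
  | zero =>
    have : (sum P 0).HasAct R f g ↔ R.EqOn g (fun _ _ => 0) := by
      simp [sum, HasAct, MatFun.mul, MatFun.const, Region.EqOn]
    simp [this]
  | succ n ih =>
    constructor
    · rintro ⟨h, k, hh, hk, hg⟩
      obtain ⟨gs, hgs, hsum⟩ := ih.1 hh
      refine ⟨Function.update gs n k, fun s hs => ?_, fun x hx t ht => ?_⟩
      · rcases eq_or_ne s n with rfl | hne
        · simpa using hk
        · rw [Function.update_of_ne hne]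
          exact hgs s (by simp at hs ⊢; omega)
      · simp only [hg x hx t ht, hsum x hx t ht, Finset.sum_range_succ, Function.update_self]
        congr 1
        refine Finset.sum_congr rfl fun s hs => ?_
        rw [Function.update_of_ne (Finset.mem_range.1 hs).ne]
    · rintro ⟨gs, hgs, hg⟩
      refine ⟨_, gs n, ih.2 ⟨gs, fun s hs => hgs s ?_, .refl _⟩, hgs n (by simp), ?_⟩
      · simp at hs ⊢; omega
      · simpa only [Finset.sum_range_succ] using hg

theorem hasAct_pow_of_step {P : IDO a a} {f : ℕ → MatFun a p}
    (h : ∀ j, P.HasAct R (f j) (f (j + 1))) (j : ℕ) : (P.pow j).HasAct R (f 0) (f j) := by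
  induction j with
  | zero =>
    intro x _ t _
    simp [MatFun.mul, MatFun.const]
  | succ j ih => exact ⟨_, ih, h j⟩

end IDO

/-! ### The operators `I ± h₁D⁻¹h₂` and their adjoints. -/

namespace IDO

variable {R : Region} {a b c p : ℕ}

/-- The adjoint reverses the factors, and `(D⁻¹)^τ = -D⁻¹` supplies the sign. -/
theorem HasAct.adj_integral {h₁ : MatFun c b} {h₂ : MatFun b a} {f : MatFun c p} {u : MatFun b p}
    (h : (dinv b).HasAct R (h₁.tr.mul f) u) :
    (integral h₁ h₂).adj.HasAct R f (fun x t => -(h₂.tr.mul u x t)) := by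
  refine ⟨_, Region.EqOn.refl _, _, ⟨_, h, Region.EqOn.refl _⟩, fun x hx t ht => ?_⟩
  simp [MatFun.mul]

theorem HasAct.one_add_integral {h₁ : MatFun a b} {h₂ : MatFun b a} {f : MatFun a p}
    {u : MatFun b p} (h : (dinv b).HasAct R (h₂.mul f) u) :
    (add (one a) (integral h₁ h₂)).HasAct R f (fun x t => f x t + h₁ x t * u x t) :=
  ⟨f, _, fun x _ t _ => by simp [MatFun.mul, MatFun.const],
    hasAct_integral_iff.2 ⟨u, h, .refl _⟩, .refl _⟩

theorem HasAct.one_sub_integral {h₁ : MatFun a b} {h₂ : MatFun b a} {f : MatFun a p}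
    {u : MatFun b p} (h : (dinv b).HasAct R (h₂.mul f) u) :
    (sub (one a) (integral h₁ h₂)).HasAct R f (fun x t => f x t - h₁ x t * u x t) :=
  ⟨f, _, fun x _ t _ => by simp [MatFun.mul, MatFun.const],
    ⟨_, hasAct_integral_iff.2 ⟨u, h, .refl _⟩, .refl _⟩,
    fun x _ t _ => by simp [MatFun.mul, sub_eq_add_neg]⟩

theorem HasAct.adj_one_add_integral {h₁ : MatFun a b} {h₂ : MatFun b a} {f : MatFun a p}
    {u : MatFun b p} (h : (dinv b).HasAct R (h₁.tr.mul f) u) :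
    (add (one a) (integral h₁ h₂)).adj.HasAct R f
      (fun x t => f x t - (h₂ x t).transpose * u x t) :=
  ⟨f, _, fun x _ t _ => by simp [MatFun.mul, MatFun.const, MatFun.tr], h.adj_integral,
    fun x _ t _ => by simp [MatFun.mul, MatFun.tr, sub_eq_add_neg]⟩

theorem HasAct.adj_one_sub_integral {h₁ : MatFun a b} {h₂ : MatFun b a} {f : MatFun a p}
    {u : MatFun b p} (h : (dinv b).HasAct R (h₁.tr.mul f) u) :
    (sub (one a) (integral h₁ h₂)).adj.HasAct R f
      (fun x t => f x t + (h₂ x t).transpose * u x t) :=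
  ⟨f, _, fun x _ t _ => by simp [MatFun.mul, MatFun.const, MatFun.tr],
    ⟨_, h.adj_integral, .refl _⟩, fun x _ t _ => by simp [MatFun.mul, MatFun.tr]⟩

end IDO

/-! ### The Darboux transformation and the dressed operator at `Φ` and `Ψ`. -/

section Darboux

open IDO

variable {R : Region} {N K : ℕ} {C : Matrix (Fin K) (Fin K) ℂ} {S : MatFun K K}

/-- `D⁻¹{Δ⁻¹ G Δ⁻¹} = C⁻¹ - Δ⁻¹` for `Δ = C + D⁻¹{G}`. -/
theorem dinv_hasAct_bdtDelta_inv {G : MatFun K K} (hC : C.det ≠ 0)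
    (hS : (dinv K).HasAct R G S)
    (hΔ : ∀ x ∈ R.space, ∀ t ∈ R.times, (bdtDelta C S x t).det ≠ 0) :
    (dinv K).HasAct R (((bdtDelta C S).inv.mul G).mul (bdtDelta C S).inv)
      (fun x t => C⁻¹ - (bdtDelta C S).inv x t) := by
  refine ⟨fun x hx t ht i j => ?_, fun t ht i j => ?_⟩
  · have hderiv : ∀ i j, HasDerivAt (fun s => bdtDelta C S s t i j) (G x t i j) x :=
      fun i j => (hS.1 x hx t ht i j).const_add (C i j)
    have hdet : ∀ᶠ s in 𝓝 x, (bdtDelta C S s t).det ≠ 0 := by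
      filter_upwards [R.isOpen_space.mem_nhds hx] with s hs using hΔ s hs t ht
    have h := (Matrix.hasDerivAt_inv hderiv hdet i j).const_sub (C⁻¹ i j)
    simpa [MatFun.mul, MatFun.inv] using h
  -- At the base point `S → 0`, so `Δ → C`; as `C` is invertible, `Δ⁻¹ → C⁻¹`, which fixes the
  -- integration constant.
  · have hlim : Tendsto (fun s => bdtDelta C S s t) R.toBase (𝓝 C) :=
      Matrix.tendsto_of_entries fun i j => by
        simpa [bdtDelta] using (hS.2 t ht i j).const_add (C i j)
    have h := (Matrix.tendsto_entry (Matrix.tendsto_inv hC hlim) i j).const_sub (C⁻¹ i j)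
    simpa [MatFun.inv] using h

variable {φ ψ : MatFun N K}

theorem bdtDelta_inv_mul_const
    (hΔ : ∀ x ∈ R.space, ∀ t ∈ R.times, (bdtDelta C S x t).det ≠ 0) {x t : ℝ}
    (hx : x ∈ R.space) (ht : t ∈ R.times) :
    (bdtDelta C S).inv x t * C = 1 - (bdtDelta C S).inv x t * S x t := by
  rw [eq_sub_iff_add_eq, ← Matrix.mul_add]
  exact Matrix.nonsing_inv_mul _ (isUnit_iff_ne_zero.2 (hΔ x hx t ht))

theorem const_mul_bdtDelta_inv
    (hΔ : ∀ x ∈ R.space, ∀ t ∈ R.times, (bdtDelta C S x t).det ≠ 0) {x t : ℝ}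
    (hx : x ∈ R.space) (ht : t ∈ R.times) :
    C * (bdtDelta C S).inv x t = 1 - S x t * (bdtDelta C S).inv x t := by
  rw [eq_sub_iff_add_eq, ← Matrix.add_mul]
  exact Matrix.mul_nonsing_inv _ (isUnit_iff_ne_zero.2 (hΔ x hx t ht))

/-- `W{φ} = Φ C`. -/
theorem bdtW_hasAct (hS : (dinv K).HasAct R (ψ.tr.mul φ) S)
    (hΔ : ∀ x ∈ R.space, ∀ t ∈ R.times, (bdtDelta C S x t).det ≠ 0) :
    (bdtW φ ψ (bdtDelta C S)).HasAct R φ ((bdtPhi φ (bdtDelta C S)).mul (.const C)) := by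
  refine (HasAct.one_sub_integral hS).congr (.refl _) fun x hx t ht => ?_
  simp only [bdtPhi, MatFun.mul, MatFun.const, Matrix.mul_assoc,
    bdtDelta_inv_mul_const hΔ hx ht, Matrix.mul_sub, Matrix.mul_one]

/-- `W⁻¹{Φ} = φ C⁻¹`. -/
theorem bdtWInv_hasAct (hC : C.det ≠ 0) (hS : (dinv K).HasAct R (ψ.tr.mul φ) S)
    (hΔ : ∀ x ∈ R.space, ∀ t ∈ R.times, (bdtDelta C S x t).det ≠ 0) :
    (bdtWInv φ ψ (bdtDelta C S)).HasAct R (bdtPhi φ (bdtDelta C S)) (φ.mul (.const C⁻¹)) := by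
  -- Here `Δ⁻¹ψ^⊤Φ = Δ⁻¹GΔ⁻¹` with `G = ψ^⊤φ`, and `Φ + φ(C⁻¹ - Δ⁻¹) = φC⁻¹`.
  have h := (dinv_hasAct_bdtDelta_inv hC hS hΔ).congr
    (f' := ((bdtDelta C S).inv.mul ψ.tr).mul (bdtPhi φ (bdtDelta C S)))
    (fun x _ t _ => by simp only [bdtPhi, MatFun.mul, Matrix.mul_assoc]) (.refl _)
  refine (HasAct.one_add_integral h).congr (.refl _) fun x hx t ht => ?_
  simp [bdtPhi, MatFun.mul, MatFun.const, Matrix.mul_sub]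

/-- `(W⁻¹)^τ{ψ} = Ψ C^⊤`. -/
theorem bdtWInv_adj_hasAct (hS : (dinv K).HasAct R (ψ.tr.mul φ) S)
    (hΔ : ∀ x ∈ R.space, ∀ t ∈ R.times, (bdtDelta C S x t).det ≠ 0) :
    (bdtWInv φ ψ (bdtDelta C S)).adj.HasAct R ψ
      ((bdtPsi ψ (bdtDelta C S)).mul (.const C.transpose)) := by
  have h := hS.dinv_tr.congr (f' := φ.tr.mul ψ) (fun x _ t _ => by
    simp only [MatFun.tr, MatFun.mul, Matrix.transpose_mul, Matrix.transpose_transpose]) (.refl _)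
  refine (HasAct.adj_one_add_integral h).congr (.refl _) fun x hx t ht => ?_
  have key := congrArg Matrix.transpose (const_mul_bdtDelta_inv hΔ hx ht)
  simp only [Matrix.transpose_mul, Matrix.transpose_sub, Matrix.transpose_one] at key
  simp only [bdtPsi, MatFun.mul, MatFun.const, MatFun.tr, Matrix.transpose_mul,
    Matrix.transpose_transpose, Matrix.mul_assoc, key, Matrix.mul_sub, Matrix.mul_one]

/-- `W^τ{Ψ} = ψ (C⁻¹)^⊤`. -/
theorem bdtW_adj_hasAct (hC : C.det ≠ 0) (hS : (dinv K).HasAct R (ψ.tr.mul φ) S)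
    (hΔ : ∀ x ∈ R.space, ∀ t ∈ R.times, (bdtDelta C S x t).det ≠ 0) :
    (bdtW φ ψ (bdtDelta C S)).adj.HasAct R (bdtPsi ψ (bdtDelta C S))
      (ψ.mul (.const C⁻¹.transpose)) := by
  have h := (dinv_hasAct_bdtDelta_inv hC hS hΔ).dinv_tr.congr
    (f' := (φ.mul (bdtDelta C S).inv).tr.mul (bdtPsi ψ (bdtDelta C S)))
    (fun x _ t _ => by
      simp only [bdtPsi, MatFun.tr, MatFun.mul, Matrix.mul_assoc, Matrix.transpose_mul,
        Matrix.transpose_transpose]) (.refl _)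
  refine (HasAct.adj_one_sub_integral h).congr (.refl _) fun x hx t ht => ?_
  simp [bdtPsi, MatFun.mul, MatFun.const, MatFun.tr, Matrix.mul_sub]

variable {Λ Λ' : Matrix (Fin K) (Fin K) ℂ} {M : IDO N N}

/-- `M̂{Φ} = Φ C Λ C⁻¹`. -/
theorem dressed_hasAct (hC : C.det ≠ 0) (hS : (dinv K).HasAct R (ψ.tr.mul φ) S)
    (hΔ : ∀ x ∈ R.space, ∀ t ∈ R.times, (bdtDelta C S x t).det ≠ 0)
    (hφ : M.HasAct R φ (φ.mul (.const Λ))) :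
    (dressed φ ψ (bdtDelta C S) M).HasAct R (bdtPhi φ (bdtDelta C S))
      ((bdtPhi φ (bdtDelta C S)).mul (.const (C * Λ * C⁻¹))) := by
  refine ⟨_, ⟨_, bdtWInv_hasAct hC hS hΔ, hφ.mul_const C⁻¹⟩, ?_⟩
  refine ((bdtW_hasAct hS hΔ).mul_const (Λ * C⁻¹)).congr ?_ ?_ <;> intro x _ t _ <;>
    simp only [MatFun.mul, MatFun.const, Matrix.mul_assoc]

/-- `M̂^τ{Ψ} = Ψ C^⊤ Λ' (C⁻¹)^⊤`. -/
theorem dressed_adj_hasAct (hC : C.det ≠ 0) (hS : (dinv K).HasAct R (ψ.tr.mul φ) S)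
    (hΔ : ∀ x ∈ R.space, ∀ t ∈ R.times, (bdtDelta C S x t).det ≠ 0)
    (hψ : M.adj.HasAct R ψ (ψ.mul (.const Λ'))) :
    (dressed φ ψ (bdtDelta C S) M).adj.HasAct R (bdtPsi ψ (bdtDelta C S))
      ((bdtPsi ψ (bdtDelta C S)).mul (.const (C.transpose * Λ' * C⁻¹.transpose))) := by
  refine ⟨_, bdtW_adj_hasAct hC hS hΔ, _, hψ.mul_const C⁻¹.transpose, ?_⟩
  refine ((bdtWInv_adj_hasAct hS hΔ).mul_const (Λ' * C⁻¹.transpose)).congr ?_ ?_ <;>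
    intro x _ t _ <;> simp only [MatFun.mul, MatFun.const, Matrix.mul_assoc]

end Darboux

/-- The powers of an operator at an eigenfunction with matrix eigenvalue `A B A'`. -/
theorem IDO.hasAct_pow_of_conj {R : Region} {N K : ℕ} {P : IDO N N} {f : MatFun N K}
    {A B A' : Matrix (Fin K) (Fin K) ℂ} (hA : A * A' = 1)
    (h : P.HasAct R f (f.mul (.const (A * B * A')))) (j : ℕ) :
    (P.pow j).HasAct R f (f.mul (.const (A * B ^ j * A'))) := by
  have hA' : A' * A = 1 := mul_eq_one_comm.1 hA
  refine (hasAct_pow_of_step (f := fun j => f.mul (.const (A * B ^ j * A'))) (fun j => ?_)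
    j).congr ?_ (.refl _)
  · refine (h.mul_const (A * B ^ j * A')).congr (.refl _) fun x _ t _ => ?_
    simp only [MatFun.mul, MatFun.const, Matrix.mul_assoc, pow_succ']
    rw [← Matrix.mul_assoc A' A, hA', Matrix.one_mul]
  · intro x _ t _
    simp [MatFun.mul, MatFun.const, hA]

/-! ### The telescoping identity. -/

section Telescope

open IDO

variable {R : Region} {N K p : ℕ} {C Λ Λ' : Matrix (Fin K) (Fin K) ℂ}

/-- Expanding `𝓜₁ = CΛ - Λ'^⊤C` turns the summand into `T (s + 1) - T s` with `T s =
CΛ^sC⁻¹(Λ'^⊤)^(l+1-s)C`, and `T (l + 1) - T 0 = 𝓜_{l+1}`. -/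
theorem sum_matM (hC : C.det ≠ 0) (l : ℕ) :
    ∑ s ∈ Finset.range (l + 1),
      (C * Λ ^ s * C⁻¹) * matM C Λ Λ' 1 * (C⁻¹ * Λ'.transpose ^ (l - s) * C) =
      matM C Λ Λ' (l + 1) := by
  have hC' : IsUnit C.det := isUnit_iff_ne_zero.2 hC
  have hstep : ∀ s ∈ Finset.range (l + 1),
      (C * Λ ^ s * C⁻¹) * matM C Λ Λ' 1 * (C⁻¹ * Λ'.transpose ^ (l - s) * C) =
      C * Λ ^ (s + 1) * C⁻¹ * Λ'.transpose ^ (l + 1 - (s + 1)) * C -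
        C * Λ ^ s * C⁻¹ * Λ'.transpose ^ (l + 1 - s) * C := by
    intro s hs
    have hs' : l + 1 - s = (l - s) + 1 := by simp at hs; omega
    simp only [matM, pow_zero, Matrix.one_mul, hs', pow_succ Λ, pow_succ' Λ'.transpose,
      Matrix.mul_sub,
      Matrix.sub_mul, Matrix.mul_assoc, Nat.add_sub_add_right,
      Matrix.nonsing_inv_mul_cancel_left _ _ hC', Matrix.mul_nonsing_inv_cancel_left _ _ hC']
  rw [Finset.sum_congr rfl hstep,
    Finset.sum_range_sub fun s => C * Λ ^ s * C⁻¹ * Λ'.transpose ^ (l + 1 - s) * C]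
  simp [matM, Matrix.mul_assoc, Matrix.nonsing_inv_mul _ hC',
    Matrix.mul_nonsing_inv_cancel_left _ _ hC']

/-- The common core of the operator identity (`P = D⁻¹`) and of the coefficient identities
(`P = D^k`), for an operator `P` which commutes with constant matrices. -/
theorem hasAct_telescope {P : IDO K K}
    (hP : ∀ {f u : MatFun K p} (A : Matrix (Fin K) (Fin K) ℂ), P.HasAct R f u →
      P.HasAct R ((MatFun.const A).mul f) ((MatFun.const A).mul u))
    (hC : C.det ≠ 0) {Φ : MatFun N K} {h : MatFun K p} {Φs : ℕ → MatFun N K}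
    {hs : ℕ → MatFun K p} (hΦs : ∀ j, R.EqOn (Φs j) (Φ.mul (.const (C * Λ ^ j * C⁻¹))))
    (hhs : ∀ j, R.EqOn (hs j) ((MatFun.const (C⁻¹ * Λ'.transpose ^ j * C)).mul h))
    (z : ℂ) (l : ℕ) (g : MatFun N p) :
    (∃ u, P.HasAct R h u ∧
      R.EqOn g (fun x t => z • ((Φ.mul (.const (matM C Λ Λ' (l + 1)))) x t * u x t))) ↔
    ∃ gs : ℕ → MatFun N p,
      (∀ s ∈ Finset.range (l + 1), ∃ u, P.HasAct R (hs (l - s)) u ∧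
        R.EqOn (gs s) (fun x t => z • (((Φs s).mul (.const (matM C Λ Λ' 1))) x t * u x t))) ∧
      R.EqOn g (fun x t => ∑ s ∈ Finset.range (l + 1), gs s x t) := by
  have hact : ∀ {u : MatFun K p} (j : ℕ), P.HasAct R h u →
      P.HasAct R (hs j) ((MatFun.const (C⁻¹ * Λ'.transpose ^ j * C)).mul u) := fun j hu =>
    (hP _ hu).congr (hhs j).symm (.refl _)
  have hsum : ∀ u : MatFun K p, R.EqOn
      (fun x t => ∑ s ∈ Finset.range (l + 1), z • (((Φs s).mul (.const (matM C Λ Λ' 1))) x t *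
        (MatFun.const (C⁻¹ * Λ'.transpose ^ (l - s) * C)).mul u x t))
      (fun x t => z • ((Φ.mul (.const (matM C Λ Λ' (l + 1)))) x t * u x t)) := by
    intro u x hx t ht
    simp only [MatFun.mul, MatFun.const, hΦs _ x hx t ht]
    rw [← sum_matM hC l, ← Finset.smul_sum, Matrix.mul_sum, Matrix.sum_mul]
    simp only [Matrix.mul_assoc]
  constructor
  · rintro ⟨u, hu, hg⟩
    exact ⟨_, fun s _ => ⟨_, hact (l - s) hu, .refl _⟩, hg.trans (hsum u).symm⟩
  · rintro ⟨gs, hgs, hg⟩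
    -- Equality of domains: the summand `s = l` involves `hs 0`, which equals `h` on the region, so
    -- its existence gives that of `P{h}`.
    obtain ⟨u, hu, -⟩ := hgs l (by simp)
    have hu' : P.HasAct R h u := hu.congr (fun x hx t ht => by
      rw [hhs _ x hx t ht]
      simp [MatFun.mul, MatFun.const, Matrix.nonsing_inv_mul _ (isUnit_iff_ne_zero.2 hC)])
      (.refl _)
    refine ⟨u, hu', hg.trans (Region.EqOn.trans (fun x hx t ht => ?_) (hsum u))⟩
    refine Finset.sum_congr rfl fun s hs => ?_
    -- By uniqueness, every other summand is the one computed from `u`.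
    obtain ⟨w, hw, hgw⟩ := hgs s hs
    rw [hgw x hx t ht]
    simp only [hw.unique (hact (l - s) hu') x hx t ht]

end Telescope

theorem lemma2 (R : Region) (N K m n : ℕ)
    (α : ℂ) (J : Matrix (Fin N) (Fin N) ℂ) (v : ℕ → MatFun N N)
    (q r : MatFun N m) (M₀ : Matrix (Fin m) (Fin m) ℂ)
    (φ ψ : MatFun N K) (Λ Λ' C : Matrix (Fin K) (Fin K) ℂ)
    (hφ : (opM n α J v q r M₀).HasAct R φ (φ.mul (.const Λ)))
    (hψ : (opM n α J v q r M₀).adj.HasAct R ψ (ψ.mul (.const Λ')))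
    (hC : C.det ≠ 0)
    (S : MatFun K K) (hS : (IDO.dinv K).HasAct R (ψ.tr.mul φ) S)
    (hΔ : ∀ x ∈ R.space, ∀ t ∈ R.times, (bdtDelta C S x t).det ≠ 0) :
    let Δ := bdtDelta C S
    let Mhat := dressed φ ψ Δ (opM n α J v q r M₀)
    let Φ := bdtPhi φ Δ
    let Ψ := bdtPsi ψ Δ
    -- the functions `Φ[j]` and `Ψ[j]` exist
    (∀ j, ∃ f, (Mhat.pow j).HasAct R Φ f) ∧
    (∀ j, ∃ f, (Mhat.adj.pow j).HasAct R Ψ f) ∧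
    ∀ Φs Ψs : ℕ → MatFun N K,
      (∀ j, (Mhat.pow j).HasAct R Φ (Φs j)) →
      (∀ j, (Mhat.adj.pow j).HasAct R Ψ (Ψs j)) →
      ∀ l : ℕ,
        -- the identity, for operators acting on matrix functions
        IDO.SameAction R
          (.integral (Φ.mul (.const (matM C Λ Λ' (l + 1)))) Ψ.tr)
          (.sum (fun s => .integral ((Φs s).mul (.const (matM C Λ Λ' 1))) (Ψs (l - s)).tr)
            (l + 1)) ∧
        -- the identity, coefficient by coefficient, for formal pseudodifferential operators
        ∀ (k : ℕ) (w : MatFun N N),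
          HasPDOCoeff R (Φ.mul (.const (matM C Λ Λ' (l + 1)))) Ψ.tr k w ↔
          ∃ ws : ℕ → MatFun N N,
            (∀ s ∈ Finset.range (l + 1),
              HasPDOCoeff R ((Φs s).mul (.const (matM C Λ Λ' 1))) (Ψs (l - s)).tr k (ws s)) ∧
            R.EqOn w (fun x t => ∑ s ∈ Finset.range (l + 1), ws s x t) := by
  intro Δ Mhat Φ Ψ
  have hCu : IsUnit C.det := isUnit_iff_ne_zero.2 hC
  have hΦ : ∀ j, (Mhat.pow j).HasAct R Φ (Φ.mul (.const (C * Λ ^ j * C⁻¹))) :=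
    IDO.hasAct_pow_of_conj (Matrix.mul_nonsing_inv _ hCu) (dressed_hasAct hC hS hΔ hφ)
  have hΨ : ∀ j, (Mhat.adj.pow j).HasAct R Ψ
      (Ψ.mul (.const (C.transpose * Λ' ^ j * C⁻¹.transpose))) :=
    IDO.hasAct_pow_of_conj
      (by rw [← Matrix.transpose_mul, Matrix.nonsing_inv_mul _ hCu, Matrix.transpose_one])
      (dressed_adj_hasAct hC hS hΔ hψ)
  refine ⟨fun j => ⟨_, hΦ j⟩, fun j => ⟨_, hΨ j⟩, fun Φs Ψs hΦs hΨs l => ?_⟩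
  -- The given `Φ[j]` and `Ψ[j]` coincide on the region with the explicit formulas.
  have hΦs' := fun j => (hΦs j).unique (hΦ j)
  have hΨs' : ∀ j, R.EqOn (Ψs j).tr
      ((MatFun.const (C⁻¹ * Λ'.transpose ^ j * C)).mul Ψ.tr) := fun j x hx t ht => by
    simp only [MatFun.tr, (hΨs j).unique (hΨ j) x hx t ht, MatFun.mul, MatFun.const,
      Matrix.transpose_mul, Matrix.transpose_transpose, Matrix.transpose_pow, Matrix.mul_assoc]
  constructor
  · intro p f g
    simp only [IDO.hasAct_integral_iff, IDO.hasAct_sum_iff]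
    -- The scalar `z` is `1` here; for the coefficient of `D^{-1-k}` it is `(-1)^k`.
    have h := hasAct_telescope (P := .dinv K) (Λ' := Λ') (fun A hu => hu.dinv_const_mul A) hC hΦs'
      (h := Ψ.tr.mul f) (hs := fun j => (Ψs j).tr.mul f)
      (fun j => ((hΨs' j).mul (.refl f)).trans fun x _ t _ => by
        simp only [MatFun.mul, Matrix.mul_assoc]) 1 l g
    simp only [one_smul] at h
    exact h
  · intro k w
    exact hasAct_telescope (fun A hu => hu.dx_pow_const_mul A) hC hΦs' hΨs' ((-1) ^ k) l w
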